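/- Let $\mathbb{T}$ be the unit circle with normalized Haar measure, let $H^2(\mathbb{T})$ be the subspace of $L^2(\mathbb{T})$ of functions whose Fourier coefficients are supported on $\{0,1,2,\dots\}$, let $\overline{H^2}(\mathbb{T})$ be the space of complex conjugates of functions in $H^2(\mathbb{T})$, and let $\overline{P}$ be the orthogonal projection from $L^2(\mathbb{T})$ onto $\overline{H^2}(\mathbb{T})$. For $\varphi \in H^2(\mathbb{T})$, let $\mathbf{H}_\varphi f = \overline{P}(\overline{\varphi} f)$ be the Hankel operator from $H^2(\mathbb{T})$ to $\overline{H^2}(\mathbb{T})$, densely defined on the set of $f \in H^2(\mathbb{T})$ with $\overline{\varphi} f \in L^2(\mathbb{T})$, and let $\|\mathbf{H}_\varphi\| \in [0,\infty]$ be its operator norm. We say that $\mathbf{H}_\varphi$ has minimal norm if $\|\mathbf{H}_\varphi\| = \|\varphi\|_{H^2(\mathbb{T})}$, that is, if equality holds in the general lower bound $\|\mathbf{H}_\varphi\| \geq \|\varphi\|_{H^2(\mathbb{T})}$. A function $I \in H^2(\mathbb{T})$ is called inner if $|I(z)| = 1$ for almost every $z \in \mathbb{T}$. Theorem. Suppose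 that $\varphi \in H^2(\mathbb{T})$. Then $\mathbf{H}_\varphi$ has minimal norm if and only if $\varphi = C I$ for some constant $C \in \mathbb{C}$ and some inner function $I$. -/

import Mathlib

open MeasureTheory
open scoped ENNReal

noncomputable section

/-- `L²(𝕋)`, where the circle `𝕋` is modelled as `ℝ/ℤ` (the point `x` stands for `e^{2πix}`) with
its normalized Haar measure. -/
abbrev L2Circle : Type := Lp ℂ 2 (@AddCircle.haarAddCircle 1 _)

/-- The Hardy space `H²(𝕋)`: the functions in `L²(𝕋)` whose Fourier coefficients are supported on
`{0, 1, 2, …}`. -/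
def hardyH2 : Submodule ℂ L2Circle where
  carrier := {f | ∀ n : ℤ, n < 0 → fourierCoeff f n = 0}
  zero_mem' n _ := by
    change fourierCoeff ((0 : L2Circle) : AddCircle (1 : ℝ) → ℂ) n = 0
    rw [← fourierBasis_repr]
    simp
  add_mem' hf hg n hn := by
    have h1 := hf n hn
    have h2 := hg n hn
    rw [← fourierBasis_repr] at h1 h2 ⊢
    simp [h1, h2]
  smul_mem' c f hf n hn := by
    have h1 := hf n hn
    rw [← fourierBasis_repr] at h1 ⊢
    simp [h1]

theorem mem_hardyH2 {f : L2Circle} :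
    f ∈ hardyH2 ↔ ∀ n : ℤ, n < 0 → fourierCoeff f n = 0 := Iff.rfl

theorem L2Circle.star_add (f g : L2Circle) : star (f + g) = star f + star g := by
  apply Lp.ext
  filter_upwards [Lp.coeFn_star (f + g), Lp.coeFn_star f, Lp.coeFn_star g, Lp.coeFn_add f g,
    Lp.coeFn_add (star f) (star g)] with x h1 h2 h3 h4 h5
  rw [h1, Pi.star_apply, h4, h5, Pi.add_apply, Pi.add_apply, h2, h3]
  simp

theorem L2Circle.star_smul (c : ℂ) (f : L2Circle) : star (c • f) = star c • star f := by
  apply Lp.ext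
  filter_upwards [Lp.coeFn_star (c • f), Lp.coeFn_star f, Lp.coeFn_smul c f,
    Lp.coeFn_smul (star c) (star f)] with x h1 h2 h3 h4
  rw [h1, Pi.star_apply, h3, h4, Pi.smul_apply, Pi.smul_apply, h2]
  simp

theorem L2Circle.norm_star (f : L2Circle) : ‖star f‖ = ‖f‖ := by
  refine le_antisymm (Lp.norm_le_norm_of_ae_le ?_) (Lp.norm_le_norm_of_ae_le ?_) <;>
  · filter_upwards [Lp.coeFn_star f] with x h1
    simp [h1]

/-- `L²(𝕋) → L²(𝕋)`, `f ↦ conj f`, is continuous. -/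
theorem L2Circle.continuous_star : Continuous (fun f : L2Circle => star f) := by
  let e : L2Circle →+ L2Circle := AddMonoidHom.mk' (fun f => star f) L2Circle.star_add
  exact (AddMonoidHomClass.isometry_of_norm e L2Circle.norm_star).continuous

/-- The space of the complex conjugates of the functions in `H²(𝕋)`. -/
def conjHardyH2 : Submodule ℂ L2Circle where
  carrier := {g | ∃ f ∈ hardyH2, g = star f}
  zero_mem' := ⟨0, zero_mem _, by
    simpa using (L2Circle.star_smul 0 0).symm⟩
  add_mem' := by
    rintro _ _ ⟨f, hf, rfl⟩ ⟨g, hg, rfl⟩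
    exact ⟨f + g, add_mem hf hg, (L2Circle.star_add f g).symm⟩
  smul_mem' := by
    rintro c _ ⟨f, hf, rfl⟩
    exact ⟨star c • f, Submodule.smul_mem _ _ hf, by rw [L2Circle.star_smul, star_star]⟩

theorem isClosed_hardyH2 : IsClosed (hardyH2 : Set L2Circle) := by
  have h : (hardyH2 : Set L2Circle) =
      ⋂ n : ℤ, ⋂ _ : n < 0, {f | inner ℂ (fourierBasis n) f = (0 : ℂ)} := by
    ext f
    simp only [SetLike.mem_coe, mem_hardyH2, Set.mem_iInter, Set.mem_ofPred_eq,
      ← fourierBasis_repr, HilbertBasis.repr_apply_apply]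
  rw [h]
  refine isClosed_iInter fun n => isClosed_iInter fun _ => ?_
  exact isClosed_eq (continuous_const.inner continuous_id) continuous_const

theorem isClosed_conjHardyH2 : IsClosed (conjHardyH2 : Set L2Circle) := by
  have h : (conjHardyH2 : Set L2Circle) = (fun f : L2Circle => star f) ⁻¹' hardyH2 := by
    ext g
    constructor
    · rintro ⟨f, hf, rfl⟩
      simpa using hf
    · intro hg
      exact ⟨star g, hg, (star_star g).symm⟩
  rw [h]
  exact isClosed_hardyH2.preimage L2Circle.continuous_star

instance : CompleteSpace conjHardyH2 := isClosed_conjHardyH2.completeSpace_coe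

/-- The subspace of those `f` in `H²(𝕋)` for which `conj φ * f` is in `L²(𝕋)`. It contains all
(analytic) polynomials, hence is dense in `H²(𝕋)`, and it is all of `H²(𝕋)` if `φ` is bounded. -/
def hankelDomain (φ : hardyH2) : Submodule ℂ hardyH2 where
  carrier := {f | MemLp (fun x => star ((φ : L2Circle) x) * (f : L2Circle) x) 2
    (@AddCircle.haarAddCircle 1 _)}
  zero_mem' := by
    have h : MemLp (fun _ => (0 : ℂ)) 2 (@AddCircle.haarAddCircle 1 _) := MemLp.zero'
    refine (memLp_congr_ae ?_).2 h
    filter_upwards [Lp.coeFn_zero ℂ 2 (@AddCircle.haarAddCircle 1 _)] with x hx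
    change star ((φ : L2Circle) x) * (0 : L2Circle) x = 0
    rw [hx]
    simp
  add_mem' := by
    intro f g hf hg
    refine (memLp_congr_ae ?_).2 (MemLp.add hf hg)
    filter_upwards [Lp.coeFn_add (f : L2Circle) (g : L2Circle)] with x hx
    change star ((φ : L2Circle) x) * ((f : L2Circle) + (g : L2Circle) : L2Circle) x = _
    rw [hx]
    exact mul_add _ _ _
  smul_mem' := by
    intro c f hf
    refine (memLp_congr_ae ?_).2 (MemLp.const_smul hf c)
    filter_upwards [Lp.coeFn_smul c (f : L2Circle)] with x hx
    change star ((φ : L2Circle) x) * (c • (f : L2Circle) : L2Circle) x = _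
    rw [hx]
    exact mul_left_comm _ _ _

theorem mem_hankelDomain {φ f : hardyH2} : f ∈ hankelDomain φ ↔
    MemLp (fun x => star ((φ : L2Circle) x) * (f : L2Circle) x) 2
      (@AddCircle.haarAddCircle 1 _) := Iff.rfl

/-- Multiplication by `conj φ`, from the domain above to `L²(𝕋)`. -/
def mulConj (φ : hardyH2) : hankelDomain φ →ₗ[ℂ] L2Circle where
  toFun f := MemLp.toLp (fun x => star ((φ : L2Circle) x) * ((f : hardyH2) : L2Circle) x)
    (mem_hankelDomain.1 f.2)
  map_add' f g := by
    refine Eq.trans (MemLp.toLp_congr _ ((mem_hankelDomain.1 f.2).add (mem_hankelDomain.1 g.2)) ?_)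
      (MemLp.toLp_add _ _)
    filter_upwards [Lp.coeFn_add ((f : hardyH2) : L2Circle) ((g : hardyH2) : L2Circle)] with x hx
    change star ((φ : L2Circle) x) *
      (((f : hardyH2) : L2Circle) + ((g : hardyH2) : L2Circle) : L2Circle) x = _
    rw [hx]
    exact mul_add _ _ _
  map_smul' c f := by
    refine Eq.trans (MemLp.toLp_congr _ ((mem_hankelDomain.1 f.2).const_smul c) ?_)
      (MemLp.toLp_const_smul _ _)
    filter_upwards [Lp.coeFn_smul c ((f : hardyH2) : L2Circle)] with x hx
    change star ((φ : L2Circle) x) * (c • ((f : hardyH2) : L2Circle) : L2Circle) x = _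
    rw [hx]
    exact mul_left_comm _ _ _

/-- The Hankel operator `H_φ f = P̄ (conj φ * f)` from `H²(𝕋)` to the space of conjugates of
functions in `H²(𝕋)`, where `P̄` is the orthogonal projection from `L²(𝕋)` onto the latter. For a
general symbol `φ` in `H²(𝕋)` it is a (possibly unbounded) densely defined operator. -/
def hankel (φ : hardyH2) : hardyH2 →ₗ.[ℂ] conjHardyH2 where
  domain := hankelDomain φ
  toFun := conjHardyH2.orthogonalProjectionOnto.toLinearMap ∘ₗ mulConj φ

/-- The operator norm of `H_φ`, a number in `[0, ∞]`; the value `∞` means that `H_φ` is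
unbounded. -/
def hankelNorm (φ : hardyH2) : ℝ≥0∞ :=
  ⨆ (f : (hankel φ).domain) (_ : ‖f‖ ≤ 1), ‖hankel φ f‖ₑ

/-- `H_φ` has minimal norm if the lower bound `‖φ‖ ≤ ‖H_φ‖` is attained (in particular `H_φ` is
then bounded). -/
def HasMinimalNorm (φ : hardyH2) : Prop := hankelNorm φ = ‖φ‖ₑ

/-- A function in `H²(𝕋)` is inner if it is unimodular almost everywhere on `𝕋`. -/
def IsInner (I : hardyH2) : Prop :=
  ∀ᵐ x ∂(@AddCircle.haarAddCircle 1 _), ‖(I : L2Circle) x‖ = 1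

end

open MeasureTheory
open scoped ENNReal ComplexConjugate

/-! The constant function 1 is the test vector: `H_φ 1 = conj φ`, so minimal norm means that `H_φ`
attains its norm at 1. A bounded operator `T` attaining its norm `M` at `a` satisfies `T*T a = M²
a`, used in the weak form `inner_map_eq_of_norm_attained`, which needs no adjoint on the
non-complete domain. Pairing with `e_n`, `n ≥ 0`, gives `∫ |φ|² e_n = ‖φ‖² ∫ e_n`
(`inner_hankel_domainExp`). As `|φ|²` is real, this extends to all `n`, so `|φ|² = ‖φ‖²` almost
everywhere (`ae_eq_const_of_integral_fourier_mul`) and `φ / ‖φ‖` is inner. Conversely,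
multiplication by the conjugate of `C I` scales norms by `|C| = ‖C I‖`, and the projection is a
contraction. -/

/-- A linear map bounded by `M` that attains this bound at `a` scales inner products with `a` by
`M ^ 2`. -/
theorem inner_map_eq_of_norm_attained {E F : Type*} [NormedAddCommGroup E] [InnerProductSpace ℂ E]
    [NormedAddCommGroup F] [InnerProductSpace ℂ F] (T : E →ₗ[ℂ] F) (M : ℝ)
    (hT : ∀ f, ‖T f‖ ≤ M * ‖f‖) (a : E) (ha : ‖T a‖ = M * ‖a‖) (b : E) :
    inner ℂ (T a) (T b) = (M : ℂ) ^ 2 * inner ℂ a b := by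
  rw [← sub_eq_zero]
  set w : ℂ := inner ℂ (T a) (T b) - (M : ℂ) ^ 2 * inner ℂ a b with hw
  -- First variation at the maximiser: in `‖T (a + t b)‖² ≤ M² ‖a + t b‖²` the terms free of `t`
  -- cancel by `ha`.
  have key : ∀ t : ℂ, 2 * (t * w).re ≤ ‖t‖ ^ 2 * (M ^ 2 * ‖b‖ ^ 2) := by
    intro t
    have h1 : ‖T (a + t • b)‖ ^ 2 ≤ (M * ‖a + t • b‖) ^ 2 :=
      pow_le_pow_left₀ (norm_nonneg _) (hT _) 2
    rw [map_add, map_smul, mul_pow, @norm_add_sq ℂ, @norm_add_sq ℂ, inner_smul_right,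
      inner_smul_right, norm_smul, norm_smul, ha] at h1
    have h2 : (t * w).re = (t * inner ℂ (T a) (T b)).re - M ^ 2 * (t * inner ℂ a b).re := by
      rw [hw, mul_sub, Complex.sub_re, mul_left_comm, ← Complex.ofReal_pow, Complex.re_ofReal_mul]
    rw [h2]
    simp only [RCLike.re_to_complex] at h1
    nlinarith [sq_nonneg (‖t‖ * ‖T b‖)]
  set K : ℝ := M ^ 2 * ‖b‖ ^ 2 with hK
  have hK0 : 0 ≤ K := by positivity
  -- This `t` makes the linear term a multiple of `‖w‖²` and small enough to beat the quadratic one;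
  -- `K + 1` avoids dividing by zero when `K = 0`.
  have h := key (((K + 1)⁻¹ : ℝ) * conj w)
  rw [mul_assoc, Complex.conj_mul', Complex.re_ofReal_mul, norm_mul, RCLike.norm_conj,
    Complex.norm_real, Real.norm_of_nonneg (by positivity), mul_pow, ← Complex.ofReal_pow,
    Complex.ofReal_re] at h
  have h3 : 2 * (K + 1) * ‖w‖ ^ 2 ≤ K * ‖w‖ ^ 2 := by
    have h4 := mul_le_mul_of_nonneg_left h (sq_nonneg (K + 1))
    field_simp at h4
    nlinarith
  have h5 : ‖w‖ ^ 2 ≤ 0 := by nlinarith [sq_nonneg ‖w‖, mul_nonneg hK0 (sq_nonneg ‖w‖)]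
  exact norm_eq_zero.1 (pow_eq_zero_iff two_ne_zero |>.1 (le_antisymm h5 (sq_nonneg _)))

theorem norm_map_le_of_unit_ball {E F : Type*} [NormedAddCommGroup E]
    [InnerProductSpace ℂ E] [NormedAddCommGroup F] [InnerProductSpace ℂ F] (T : E →ₗ[ℂ] F) {M : ℝ}
    (hT : ∀ f, ‖f‖ ≤ 1 → ‖T f‖ ≤ M) (f : E) : ‖T f‖ ≤ M * ‖f‖ := by
  rcases eq_or_ne f 0 with rfl | hf
  · simp
  have hn : 0 < ‖f‖ := norm_pos_iff.2 hf
  have h := hT (((‖f‖⁻¹ : ℝ) : ℂ) • f) (by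
    rw [norm_smul, Complex.norm_real, norm_inv, norm_norm, inv_mul_cancel₀ hn.ne'])
  rw [map_smul, norm_smul, Complex.norm_real, norm_inv, norm_norm, inv_mul_le_iff₀ hn] at h
  rwa [mul_comm]

/-- A nonnegative integrable function on the circle with the Fourier coefficients of a constant
is constant almost everywhere. -/
theorem ae_eq_const_of_integral_fourier_mul {T : ℝ} [Fact (0 < T)] {g : AddCircle T → ℝ}
    (hg : Integrable g AddCircle.haarAddCircle) (hg0 : ∀ x, 0 ≤ g x) {c : ℝ} (hc : 0 ≤ c)
    (h : ∀ n : ℤ, ∫ x, fourier n x * (g x : ℂ) ∂AddCircle.haarAddCircle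
      = ∫ x, fourier n x * (c : ℂ) ∂(AddCircle.haarAddCircle (T := T))) :
    g =ᵐ[AddCircle.haarAddCircle] fun _ => c := by
  set μ : Measure (AddCircle T) := AddCircle.haarAddCircle
  have hint : ∀ {u : AddCircle T → ℝ}, Integrable u μ → ∀ f : C(AddCircle T, ℂ),
      Integrable (fun x => f x * (u x : ℂ)) μ := fun hu f =>
    hu.ofReal.bdd_mul (c := ‖f‖) f.continuous.aestronglyMeasurable
      (Filter.Eventually.of_forall f.norm_coe_le_norm)
  have hcont : ∀ {u : AddCircle T → ℝ}, Integrable u μ →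
      Continuous fun f : C(AddCircle T, ℂ) => ∫ x, f x * (u x : ℂ) ∂μ := by
    intro u hu
    let L : C(AddCircle T, ℂ) →ₗ[ℂ] ℂ :=
      { toFun f := ∫ x, f x * (u x : ℂ) ∂μ
        map_add' f f' := by
          simp only [ContinuousMap.add_apply, add_mul]
          exact integral_add (hint hu f) (hint hu f')
        map_smul' a f := by
          simp only [ContinuousMap.smul_apply, smul_eq_mul, mul_assoc, RingHom.id_apply]
          exact integral_const_mul _ _ }
    refine (L.mkContinuous (∫ x, ‖u x‖ ∂μ) fun f => ?_).continuous
    change ‖∫ x, f x * (u x : ℂ) ∂μ‖ ≤ _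
    rw [mul_comm, ← integral_const_mul]
    refine norm_integral_le_of_norm_le (hu.norm.const_mul _) (Filter.Eventually.of_forall fun x => ?_)
    rw [norm_mul, Complex.norm_real]
    gcongr
    exact f.norm_coe_le_norm x
  have hcint : Integrable (fun _ : AddCircle T => c) μ := integrable_const c
  -- Trigonometric polynomials are uniformly dense, and both sides are continuous in `f` for the sup
  -- norm.
  have hall : ∀ f : C(AddCircle T, ℂ), ∫ x, f x * (g x : ℂ) ∂μ = ∫ x, f x * (c : ℂ) ∂μ := by
    intro f
    have hf : f ∈ (Submodule.span ℂ (Set.range (@fourier T))).topologicalClosure := by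
      rw [span_fourier_closure_eq_top]; trivial
    refine closure_minimal (t := {f : C(AddCircle T, ℂ) | ∫ x, f x * (g x : ℂ) ∂μ
      = ∫ x, f x * (c : ℂ) ∂μ}) ?_ (isClosed_eq (hcont hg) (hcont hcint)) hf
    intro p hp
    induction hp using Submodule.span_induction with
    | mem p hp => obtain ⟨n, rfl⟩ := hp; exact h n
    | zero => simp
    | add p q _ _ hp hq =>
      simp only [Set.mem_ofPred_eq, ContinuousMap.add_apply, add_mul] at hp hq ⊢
      rw [integral_add (hint hg p) (hint hg q), integral_add (hint hcint p) (hint hcint q), hp, hq]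
    | smul a p _ hp =>
      simp only [Set.mem_ofPred_eq, ContinuousMap.smul_apply, smul_eq_mul, mul_assoc] at hp ⊢
      rw [integral_const_mul, integral_const_mul, hp]
  have hfin : ∀ {u : AddCircle T → ℝ}, Integrable u μ →
      IsFiniteMeasure (μ.withDensity fun x => ENNReal.ofReal (u x)) := fun hu =>
    isFiniteMeasure_withDensity_ofReal hu.2
  have := hfin hg
  have := hfin hcint
  -- As `g` and `c` are nonnegative, they are densities of finite measures, which are determined by
  -- integrals of continuous functions.
  have hm : μ.withDensity (fun x => ENNReal.ofReal (g x))
      = μ.withDensity (fun _ => ENNReal.ofReal c) := by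
    refine ext_of_forall_integral_eq_of_IsFiniteMeasure fun f => ?_
    rw [integral_withDensity_eq_integral_toReal_smul₀ hg.1.aemeasurable.ennreal_ofReal (by simp),
      integral_withDensity_eq_integral_toReal_smul₀ (by fun_prop) (by simp)]
    have hf := hall ⟨fun x => (f x : ℂ), by fun_prop⟩
    simp only [ContinuousMap.coe_mk, ← Complex.ofReal_mul, integral_complex_ofReal] at hf
    have hf' := Complex.ofReal_injective hf
    simpa only [ENNReal.toReal_ofReal (hg0 _), ENNReal.toReal_ofReal hc, smul_eq_mul,
      mul_comm] using hf'
  rw [withDensity_eq_iff_of_sigmaFinite hg.1.aemeasurable.ennreal_ofReal (by fun_prop)] at hm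
  filter_upwards [hm] with x hx
  exact (ENNReal.ofReal_eq_ofReal_iff (hg0 x) hc).1 hx

noncomputable section

/-- The exponential `x ↦ e^{2πinx}`, `n ≥ 0`, as an element of `H²(𝕋)`. -/
def hardyExp (n : ℕ) : hardyH2 :=
  ⟨fourierLp 2 (n : ℤ), fun m hm => by
    rw [← fourierBasis_repr, HilbertBasis.repr_apply_apply, ← coe_fourierBasis]
    exact fourierBasis.orthonormal.2 (by omega)⟩

theorem coeFn_hardyExp (n : ℕ) :
    ((hardyExp n : L2Circle) : AddCircle (1 : ℝ) → ℂ) =ᵐ[AddCircle.haarAddCircle] fourier (n : ℤ) :=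
  coeFn_fourierLp 2 n

theorem norm_fourier_apply {T : ℝ} (n : ℤ) (x : AddCircle T) : ‖fourier n x‖ = 1 := by
  rw [fourier_apply, Circle.norm_coe]

theorem hardyExp_mem_hankelDomain (φ : hardyH2) (n : ℕ) : hardyExp n ∈ hankelDomain φ := by
  rw [mem_hankelDomain]
  refine (Lp.memLp (φ : L2Circle)).of_le
    ((Lp.memLp _).1.star.mul (Lp.memLp (hardyExp n : L2Circle)).1) ?_
  filter_upwards [coeFn_hardyExp n] with x hx
  simp [hx, norm_fourier_apply, -fourier_apply]

/-- The exponential `x ↦ e^{2πinx}` as an element of the domain of `H_φ`. -/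
def domainExp (φ : hardyH2) (n : ℕ) : hankelDomain φ :=
  ⟨hardyExp n, hardyExp_mem_hankelDomain φ n⟩

theorem norm_domainExp (φ : hardyH2) (n : ℕ) : ‖domainExp φ n‖ = 1 := by
  have h := (orthonormal_fourier (T := 1)).1 (n : ℤ)
  exact h

theorem coeFn_mulConj (φ : hardyH2) (f : hankelDomain φ) :
    (mulConj φ f : AddCircle (1 : ℝ) → ℂ) =ᵐ[AddCircle.haarAddCircle]
      fun x => star ((φ : L2Circle) x) * ((f : hardyH2) : L2Circle) x :=
  MemLp.coeFn_toLp (mem_hankelDomain.1 f.2)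

/-- The Hankel operator `H_φ` as a linear map on `hankelDomain φ`. -/
def hankelMap (φ : hardyH2) : hankelDomain φ →ₗ[ℂ] conjHardyH2 :=
  conjHardyH2.orthogonalProjectionOnto.toLinearMap ∘ₗ mulConj φ

theorem hankelMap_apply (φ : hardyH2) (f : hankelDomain φ) :
    hankelMap φ f = conjHardyH2.orthogonalProjectionOnto (mulConj φ f) := rfl

theorem hankelNorm_eq (φ : hardyH2) :
    hankelNorm φ = ⨆ (f : hankelDomain φ) (_ : ‖f‖ ≤ 1), ‖hankelMap φ f‖ₑ := rfl

/-- The projection acts trivially, since `conj φ` already lies in its range. -/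
theorem hankel_domainExp_zero (φ : hardyH2) :
    (hankelMap φ (domainExp φ 0) : L2Circle) = star (φ : L2Circle) := by
  have h : mulConj φ (domainExp φ 0) = star (φ : L2Circle) := by
    apply Lp.ext
    filter_upwards [coeFn_mulConj φ (domainExp φ 0), coeFn_hardyExp 0,
      Lp.coeFn_star (φ : L2Circle)] with x h1 h2 h3
    rw [h1, h3, Pi.star_apply]
    change _ * (hardyExp 0 : L2Circle) x = _
    rw [h2]
    simp
  rw [hankelMap_apply, h]
  exact congrArg Subtype.val (conjHardyH2.orthogonalProjectionOnto_mem_subspace_eq_self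
    ⟨star (φ : L2Circle), φ, φ.2, rfl⟩)

theorem norm_hankel_domainExp_zero (φ : hardyH2) :
    ‖hankelMap φ (domainExp φ 0)‖ = ‖φ‖ := by
  change ‖(hankelMap φ (domainExp φ 0) : L2Circle)‖ = ‖(φ : L2Circle)‖
  rw [hankel_domainExp_zero, L2Circle.norm_star]

/-- The general lower bound for the norm of a Hankel operator. -/
theorem enorm_le_hankelNorm (φ : hardyH2) : ‖φ‖ₑ ≤ hankelNorm φ := by
  rw [hankelNorm_eq]
  refine le_iSup₂_of_le (domainExp φ 0) (norm_domainExp φ 0).le ?_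
  exact enorm_le_iff_norm_le.2 (norm_hankel_domainExp_zero φ).ge

theorem norm_hankel_le (φ : hardyH2) (h : hankelNorm φ ≤ ‖φ‖ₑ) (f : hankelDomain φ) :
    ‖hankelMap φ f‖ ≤ ‖φ‖ * ‖f‖ := by
  have hunit : ∀ g : hankelDomain φ, ‖g‖ ≤ 1 → ‖hankelMap φ g‖ ≤ ‖φ‖ := fun g hg =>
    enorm_le_iff_norm_le.1 ((le_iSup₂ (f := fun (f : hankelDomain φ) (_ : ‖f‖ ≤ 1) =>
      ‖hankelMap φ f‖ₑ) g hg).trans h)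
  have hbound := norm_map_le_of_unit_ball (E := hankelDomain φ) (hankelMap φ) hunit
  exact hbound f

/-- The left vector is in the range of the projection, so the projection on the right can be
dropped, leaving `⟨conj φ, conj φ e_n⟩`. -/
theorem inner_hankel_domainExp (φ : hardyH2) (n : ℕ) :
    inner ℂ (hankelMap φ (domainExp φ 0)) (hankelMap φ (domainExp φ n)) =
      ∫ x, fourier (n : ℤ) x * ((‖(φ : L2Circle) x‖ ^ 2 : ℝ) : ℂ)
        ∂(AddCircle.haarAddCircle (T := 1)) := by
  rw [hankelMap_apply φ (domainExp φ n), Submodule.inner_orthogonalProjectionOnto_eq_of_mem_left,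
    hankel_domainExp_zero, L2.inner_def]
  refine integral_congr_ae ?_
  filter_upwards [coeFn_mulConj φ (domainExp φ n), coeFn_hardyExp n,
    Lp.coeFn_star (φ : L2Circle)] with x h1 h2 h3
  rw [h1, h3, Pi.star_apply]
  change inner ℂ _ (_ * (hardyExp n : L2Circle) x) = _
  rw [h2, Complex.ofReal_pow, ← Complex.conj_mul']
  simp only [RCLike.inner_apply, Complex.star_def, Complex.conj_conj]
  ring

theorem inner_domainExp (φ : hardyH2) (n : ℕ) :
    inner ℂ (domainExp φ 0) (domainExp φ n) =
      ∫ x, fourier (n : ℤ) x ∂(AddCircle.haarAddCircle (T := 1)) := by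
  change inner ℂ (hardyExp 0 : L2Circle) (hardyExp n : L2Circle) = _
  rw [L2.inner_def]
  refine integral_congr_ae ?_
  filter_upwards [coeFn_hardyExp 0, coeFn_hardyExp n] with x h1 h2
  rw [h1, h2]
  simp

theorem HasMinimalNorm.norm_ae_eq {φ : hardyH2} (h : HasMinimalNorm φ) :
    ∀ᵐ x ∂(AddCircle.haarAddCircle (T := 1)), ‖(φ : L2Circle) x‖ = ‖φ‖ := by
  have hpos : ∀ n : ℕ, ∫ x, fourier (n : ℤ) x * ((‖(φ : L2Circle) x‖ ^ 2 : ℝ) : ℂ)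
      ∂(AddCircle.haarAddCircle (T := 1)) =
      ∫ x, fourier (n : ℤ) x * ((‖φ‖ ^ 2 : ℝ) : ℂ) ∂(AddCircle.haarAddCircle (T := 1)) := by
    intro n
    rw [← inner_hankel_domainExp, inner_map_eq_of_norm_attained (hankelMap φ) ‖φ‖
      (norm_hankel_le φ (le_of_eq h)) (domainExp φ 0)
      (by rw [norm_hankel_domainExp_zero, norm_domainExp, mul_one]) (domainExp φ n),
      inner_domainExp, integral_mul_const, mul_comm, Complex.ofReal_pow]
  -- Conjugation passes from `n` to `-n` for real functions, supplying the frequencies that `H²`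
  -- does not see.
  have hconj : ∀ (n : ℤ) (u : AddCircle (1 : ℝ) → ℝ),
      ∫ x, fourier (-n) x * (u x : ℂ) ∂(AddCircle.haarAddCircle (T := 1)) =
      conj (∫ x, fourier n x * (u x : ℂ) ∂(AddCircle.haarAddCircle (T := 1))) := by
    intro n u
    rw [← integral_conj]
    simp only [map_mul, Complex.conj_ofReal, fourier_neg]
  have hg : Integrable (fun x => ‖(φ : L2Circle) x‖ ^ 2) (AddCircle.haarAddCircle (T := 1)) :=
    (Lp.memLp (φ : L2Circle)).integrable_norm_pow two_ne_zero
  have hae := ae_eq_const_of_integral_fourier_mul hg (fun x => by positivity)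
    (sq_nonneg ‖φ‖) (by
      intro n
      obtain ⟨m, rfl | rfl⟩ := n.eq_nat_or_neg
      · exact hpos m
      · rw [hconj, hpos m, hconj m fun _ => ‖φ‖ ^ 2])
  filter_upwards [hae] with x hx
  exact (pow_left_inj₀ (norm_nonneg _) (norm_nonneg _) two_ne_zero).1 hx

theorem isInner_hardyExp (n : ℕ) : IsInner (hardyExp n) := by
  filter_upwards [coeFn_hardyExp n] with x hx
  rw [hx, norm_fourier_apply]

theorem coeFn_smul_hardyH2 (C : ℂ) (I : hardyH2) :
    (((C • I : hardyH2) : L2Circle) : AddCircle (1 : ℝ) → ℂ) =ᵐ[AddCircle.haarAddCircle]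
      fun x => C * (I : L2Circle) x := by
  filter_upwards [Lp.coeFn_smul C (I : L2Circle)] with x hx
  exact hx

theorem IsInner.norm_eq_one {I : hardyH2} (hI : IsInner I) : ‖I‖ = 1 := by
  -- Pointwise comparison with the constant function 1, whose norm is known.
  refine Eq.trans ?_ (norm_domainExp I 0)
  refine le_antisymm (Lp.norm_le_norm_of_ae_le ?_) (Lp.norm_le_norm_of_ae_le ?_) <;>
  · filter_upwards [hI, isInner_hardyExp 0] with x h1 h2
    first | exact (h1.trans h2.symm).le | exact (h2.trans h1.symm).le

theorem IsInner.hasMinimalNorm_smul {I : hardyH2} (hI : IsInner I) (C : ℂ) :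
    HasMinimalNorm (C • I) := by
  refine le_antisymm (iSup₂_le fun f hf => ?_) (enorm_le_hankelNorm _)
  refine enorm_le_iff_norm_le.2 ?_
  change ‖conjHardyH2.orthogonalProjectionOnto (mulConj (C • I) f)‖ ≤ _
  refine (Submodule.norm_orthogonalProjectionOnto_apply_le _ _).trans ?_
  rw [norm_smul, hI.norm_eq_one, mul_one]
  refine (Lp.norm_le_mul_norm_of_ae_le_mul (c := ‖C‖) (g := ((f : hardyH2) : L2Circle)) ?_).trans
    (mul_le_of_le_one_right (norm_nonneg C) hf)
  filter_upwards [coeFn_mulConj (C • I) f, coeFn_smul_hardyH2 C I, hI] with x h1 h2 h3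
  rw [h1, h2, norm_mul, norm_star, norm_mul, h3, mul_one]

end

theorem theorem1p1 (φ : hardyH2) :
    HasMinimalNorm φ ↔ ∃ (C : ℂ) (I : hardyH2), IsInner I ∧ φ = C • I := by
  constructor
  · intro h
    rcases eq_or_ne φ 0 with rfl | hφ
    -- For `φ = 0` normalising is impossible, but `C = 0` works with any inner function.
    · exact ⟨0, hardyExp 0, isInner_hardyExp 0, (zero_smul _ _).symm⟩
    have hn : ‖φ‖ ≠ 0 := norm_ne_zero_iff.2 hφ
    have hnC : (‖φ‖ : ℂ) ≠ 0 := Complex.ofReal_ne_zero.2 hn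
    refine ⟨‖φ‖, (‖φ‖ : ℂ)⁻¹ • φ, ?_, (smul_inv_smul₀ hnC φ).symm⟩
    filter_upwards [h.norm_ae_eq, coeFn_smul_hardyH2 (‖φ‖ : ℂ)⁻¹ φ] with x h1 h2
    rw [h2, norm_mul, h1, norm_inv, Complex.norm_real, norm_norm, inv_mul_cancel₀ hn]
  · rintro ⟨C, I, hI, rfl⟩
    exact hI.hasMinimalNorm_smul C
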